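/- Graphs are finite multigraphs; loops and parallel edges are allowed. Let $G=(V,E)$ be a connected graph. Give its edges an arbitrary orientation and let $M_G$ be the resulting signed incidence matrix (rows indexed by vertices, columns by edges; entry $+1$ at the head and $-1$ at the tail of an edge, the column of a loop being zero) with the row of one arbitrarily chosen special vertex deleted. For $|V|>1$ and $E\neq\emptyset$ put $L=\operatorname{lcm}(|V|-1,|E|)$, $\mathcal V_G=L/(|V|-1)$, $\mathcal E_G=L/|E|$. For every prime $p=n\mathcal V_G+1$ with $n$ a positive integer, let $$\mathrm{GPerm}^{[p]}(G)=\operatorname{Perm}\bigl(\mathbf 1_{n\mathcal V_G\times n\mathcal E_G}\otimes M_G\bigr) \bmod p ,$$ where $\mathbf 1_{a\times b}$ is the $a\times b$ all-ones matrix, $\otimes$ is the Kronecker product and $\operatorname{Perm}$ is the permanent. The extended graph permanent of $G$ is the sequence of these residues, indexed by the increasing sequence of all such primes. Let $G=(V,E)$ be a connected planar graph with $|V|>1$ and $|E|>|V|-1$ (that is, $G$ is not a tree). Fix an embedding of $G$ in the sphere, and let $G^*$ be the corresponding planar dual, whose edges are identified with those of $G$. Then the following hold, for all choices of special vertices in $G$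 and in $G^*$. 1. The extended graph permanents of $G$ and of $G^*$ are defined at the same primes. 2. Let $G$ be oriented arbitrarily and let $G^*$ carry the dual orientation (each dual edge crosses its edge from one fixed side, say the left, to the other). Then at every prime $p=n\mathcal V_G+1$, $n\ge 1$, $$\mathrm{GPerm}^{[p]}(G)\equiv(-1)^{|E|-|V|+1}\,\bigl((n\mathcal E_G)!\bigr)^{|E|}\,\mathrm{GPerm}^{[p]}(G^*)\pmod p .$$ If $G$ and $G^*$ are oriented independently and arbitrarily, there is $\varepsilon\in\{1,-1\}$, depending only on the embedding and the two orientations (not on $p$ or the special vertices), such that the same congruence holds at all these primes with the right-hand side multiplied by $\varepsilon^{\,n\mathcal E_G}$. 3. Suppose moreover that $|E|=2(|V|-1)$. Then $G$ and $G^*$ have equal extended graph permanents, up to the orientation sign convention. That is, for arbitrary orientations of $G$ and $G^*$ there is $\varepsilon\in\{1,-1\}$ with $\mathrm{GPerm}^{[p]}(G)\equiv\varepsilon^{n}\,\mathrm{GPerm}^{[p]}(G^*)\pmod p$ for all odd primes $p=2n+1$ and all choices of special vertices. Moreover, either the two extended graph permanents are equal as sequences for all choices of special vertices, or they become equal as sequences,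 for all choices of special vertices, after reversing the direction of any single edge of $G$. -/

import Mathlib

open scoped Graph Kronecker

namespace EGP

universe u v w

/-- A multigraph is connected if it has a vertex and any two of its vertices are joined by a
walk. -/
def IsConnected {α : Type u} {β : Type v} (G : Graph α β) : Prop :=
  V(G).Nonempty ∧ ∀ x ∈ V(G), ∀ y ∈ V(G), Relation.ReflTransGen G.Adj x y

/-! ### Orientations and signed incidence matrices -/

/-- An orientation of a multigraph: every edge gets a tail and a head, which are its two ends
(and coincide if the edge is a loop). -/
@[ext]
structure Orientation {α : Type u} {β : Type v} (G : Graph α β) where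
  tail : E(G) → V(G)
  head : E(G) → V(G)
  isLink : ∀ e : E(G), G.IsLink e (tail e) (head e)

open Classical in
/-- The orientation obtained by reversing the direction of the single edge `e`. -/
noncomputable def Orientation.reverse {α : Type u} {β : Type v} {G : Graph α β}
    (o : Orientation G) (e : E(G)) : Orientation G where
  tail f := if f = e then o.head f else o.tail f
  head f := if f = e then o.tail f else o.head f
  isLink f := by
    by_cases h : f = e
    · simpa only [if_pos h] using (o.isLink f).symm
    · simpa only [if_neg h] using o.isLink f

open Classical in
/-- The signed incidence matrix: the entry at `(v, e)` is `1` if `v` is the head of `e`, `-1` if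
`v` is the tail of `e`, and `0` otherwise (a loop gives a zero column). -/
noncomputable def incidenceMatrix {α : Type u} {β : Type v} {G : Graph α β}
    (o : Orientation G) : Matrix V(G) E(G) ℤ :=
  Matrix.of fun x e => (if o.head e = x then 1 else 0) - (if o.tail e = x then 1 else 0)

/-- The signed incidence matrix with the row of the special vertex `s` deleted. -/
noncomputable def reducedIncidenceMatrix {α : Type u} {β : Type v} {G : Graph α β}
    (o : Orientation G) (s : V(G)) : Matrix {x : V(G) // x ≠ s} E(G) ℤ :=
  (incidenceMatrix o).submatrix Subtype.val id

/-! ### The extended graph permanent -/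

open Classical in
/-- The permanent of a matrix whose rows and columns are indexed by finite types of the same
cardinality: the sum over all bijections from rows to columns of the products of the selected
entries. -/
noncomputable def perm {R : Type*} [CommSemiring R] {m n : Type*} [Finite m] [Finite n]
    (A : Matrix m n R) : R :=
  letI := Fintype.ofFinite m
  letI := Fintype.ofFinite n
  ∑ σ : m ≃ n, ∏ i, A i (σ i)

/-- However the rows and columns are numbered, `perm` is the usual permanent. -/
theorem perm_eq_permanent {R : Type*} [CommSemiring R] {m n k : Type*} [Finite m] [Finite n]
    [Fintype k] [DecidableEq k] (A : Matrix m n R) (r : k ≃ m) (c : k ≃ n) :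
    perm A = (A.submatrix r c).permanent := by
  classical
  let _ := Fintype.ofFinite m
  let _ := Fintype.ofFinite n
  have h : perm A = ∑ σ : m ≃ n, ∏ i, A i (σ i) := by
    unfold perm
    congr!
  rw [h, Matrix.permanent]
  refine Fintype.sum_equiv
    ((Equiv.equivCongr r.symm c.symm).trans (Equiv.inv (Equiv.Perm k))) _ _ fun σ => ?_
  refine Fintype.prod_equiv (σ.trans c.symm) _ _ fun i => ?_
  simp [Matrix.submatrix, Equiv.equivCongr, Equiv.Perm.inv_def]

/-- The number `lcm(|V| - 1, |E|) / (|V| - 1)` of copies of each row in the fundamental matrix. -/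
noncomputable def rowCopies {α : Type u} {β : Type v} (G : Graph α β) : ℕ :=
  Nat.lcm (Nat.card V(G) - 1) (Nat.card E(G)) / (Nat.card V(G) - 1)

/-- The number `lcm(|V| - 1, |E|) / |E|` of copies of each column in the fundamental matrix. -/
noncomputable def colCopies {α : Type u} {β : Type v} (G : Graph α β) : ℕ :=
  Nat.lcm (Nat.card V(G) - 1) (Nat.card E(G)) / Nat.card E(G)

/-- The all-ones matrix with `m` rows and `n` columns. -/
def onesMatrix (m n : ℕ) : Matrix (Fin m) (Fin n) ℤ :=
  Matrix.of fun _ _ => 1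

/-- The fundamental block matrix of a graph. -/
noncomputable def fundamentalMatrix {α : Type u} {β : Type v} {G : Graph α β}
    (o : Orientation G) (s : V(G)) :
    Matrix (Fin (rowCopies G) × {x : V(G) // x ≠ s}) (Fin (colCopies G) × E(G)) ℤ :=
  onesMatrix (rowCopies G) (colCopies G) ⊗ₖ reducedIncidenceMatrix o s

/-- The primes `p = n 𝒱 + 1`, `n` a positive integer, at which the extended graph permanent has
a value; here `𝒱` is `rowCopies G`. -/
def IsGPermPrime {α : Type u} {β : Type v} (G : Graph α β) (p : ℕ) : Prop :=
  p.Prime ∧ ∃ n : ℕ, 0 < n ∧ p = n * rowCopies G + 1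

/-- The graph permanent at a prime `p = n 𝒱 + 1`, so that `n = (p - 1) / 𝒱`: the residue modulo
`p` of the permanent of `n × n` blocks of the fundamental matrix. It depends on the orientation
and a priori on the special vertex. -/
noncomputable def gPerm {α : Type u} {β : Type v} {G : Graph α β} [Finite V(G)] [Finite E(G)]
    (o : Orientation G) (s : V(G)) (p : ℕ) : ZMod p :=
  ((perm (onesMatrix ((p - 1) / rowCopies G) ((p - 1) / rowCopies G) ⊗ₖ
    fundamentalMatrix o s) : ℤ) : ZMod p)

/-- The extended graph permanent: the sequence `(p i, gPerm at p i)`, where `p 0 < p 1 < ...` is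
the increasing sequence of all primes of the form `n 𝒱 + 1` with `n` positive. -/
noncomputable def extendedGraphPermanent {α : Type u} {β : Type v} {G : Graph α β}
    [Finite V(G)] [Finite E(G)] (o : Orientation G) (s : V(G)) : ℕ → Σ p : ℕ, ZMod p :=
  fun i => ⟨Nat.nth (IsGPermPrime G) i, gPerm o s (Nat.nth (IsGPermPrime G) i)⟩

/-! ### Plane embeddings and planar duals -/

/-- A rotation system of a multigraph `G` without isolated vertices, i.e. an embedding of `G` in
an oriented surface, up to orientation-preserving homeomorphism. Every edge is made up of two
darts (its two directions), interchanged by `rev`; the dart `d` leaves the vertex `vert d`, and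
`next` sends a dart to the following one in the cyclic order of the darts that leave the same
vertex. -/
structure RotationSystem {α : Type u} {β : Type v} (G : Graph α β) (D : Type w) where
  vert : D → α
  edge : D → β
  rev : Equiv.Perm D
  next : Equiv.Perm D
  rev_rev : ∀ d, rev (rev d) = d
  rev_ne : ∀ d, rev d ≠ d
  edge_eq_iff : ∀ d d', edge d = edge d' ↔ d' = d ∨ d' = rev d
  exists_dart : ∀ e ∈ E(G), ∃ d, edge d = e
  isLink : ∀ d, G.IsLink (edge d) (vert d) (vert (rev d))
  vert_eq_iff : ∀ d d', vert d = vert d' ↔ next.SameCycle d d'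

namespace RotationSystem

variable {α : Type u} {β : Type v} {G : Graph α β} {D : Type w}

/-- The permutation that walks around the boundaries of the faces: run along the dart `d` to its
other end, and continue with the following dart there. -/
def facePerm (m : RotationSystem G D) : Equiv.Perm D := m.rev.trans m.next

/-- The faces of the embedding: the cycles of the face permutation. -/
def Face (m : RotationSystem G D) : Type w :=
  Quotient (Equiv.Perm.SameCycle.setoid m.facePerm)

/-- The face that lies on a fixed side (the same for all darts) of the dart `d`. The face on the
other side is that of `rev d`. -/
def face (m : RotationSystem G D) (d : D) : m.Face :=
  Quotient.mk (Equiv.Perm.SameCycle.setoid m.facePerm) d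

instance [Finite D] (m : RotationSystem G D) : Finite m.Face :=
  inferInstanceAs (Finite (Quotient _))

/-- The dual graph of an embedded graph: its vertices are the faces, it has the same edges, and
an edge joins the two faces on its two sides. -/
def dual (m : RotationSystem G D) : Graph m.Face β where
  vertexSet := Set.univ
  edgeSet := E(G)
  IsLink e f g := ∃ d, m.edge d = e ∧ m.face d = f ∧ m.face (m.rev d) = g
  isLink_symm := by
    intro e _
    refine ⟨?_⟩
    rintro f g ⟨d, hd, hf, hg⟩
    exact ⟨m.rev d, hd ▸ ((m.edge_eq_iff d (m.rev d)).2 (Or.inr rfl)).symm, hg,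
      (m.rev_rev d).symm ▸ hf⟩
  eq_or_eq_of_isLink_of_isLink := by
    rintro e f g f' g' ⟨d, hd, hf, -⟩ ⟨d', hd', hf', hg'⟩
    rcases (m.edge_eq_iff d' d).1 (hd'.trans hd.symm) with h | h
    · subst h
      exact Or.inl (hf.symm.trans hf')
    · subst h
      exact Or.inr (hf.symm.trans hg')
  edge_mem_iff_exists_isLink := by
    intro e
    constructor
    · intro he
      obtain ⟨d, hd⟩ := m.exists_dart e he
      exact ⟨_, _, d, hd, rfl, rfl⟩
    · rintro ⟨f, g, d, hd, -⟩
      exact hd ▸ (m.isLink d).edge_mem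
  left_mem_of_isLink := fun _ _ _ _ => Set.mem_univ _

instance [Finite D] (m : RotationSystem G D) : Finite V(m.dual) :=
  Subtype.finite

instance [Finite E(G)] (m : RotationSystem G D) : Finite E(m.dual) :=
  inferInstanceAs (Finite E(G))

/-- For a connected graph with at least one edge: the surface is the sphere, i.e. its Euler
characteristic `|V| - |E| + |F|` is `2`. -/
def IsPlane (m : RotationSystem G D) : Prop :=
  (Nat.card V(G) : ℤ) - Nat.card E(G) + Nat.card m.Face = 2

/-- The orientation `o'` of the dual graph is dual to the orientation `o` of `G`: every dual edge
crosses the edge from a fixed side (the same for all edges) to the other one. -/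
def IsDualOrientation (m : RotationSystem G D) (o : Orientation G) (o' : Orientation m.dual) :
    Prop :=
  ∀ e (he : e ∈ E(G)), ∃ d, m.edge d = e ∧
    (o.tail ⟨e, he⟩ : α) = m.vert d ∧ (o.head ⟨e, he⟩ : α) = m.vert (m.rev d) ∧
    (o'.tail ⟨e, he⟩ : m.Face) = m.face d ∧ (o'.head ⟨e, he⟩ : m.Face) = m.face (m.rev d)

/-- Every orientation has a dual orientation. -/
theorem exists_isDualOrientation (m : RotationSystem G D) (o : Orientation G) :
    ∃ o' : Orientation m.dual, m.IsDualOrientation o o' := by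
  have h : ∀ e : E(G), ∃ d, m.edge d = e ∧
      (o.tail e : α) = m.vert d ∧ (o.head e : α) = m.vert (m.rev d) := by
    intro e
    obtain ⟨d, hd⟩ := m.exists_dart e e.2
    have hl := m.isLink d
    rw [hd] at hl
    rcases (o.isLink e).eq_and_eq_or_eq_and_eq hl with ⟨h1, h2⟩ | ⟨h1, h2⟩
    · exact ⟨d, hd, h1, h2⟩
    · exact ⟨m.rev d, hd ▸ ((m.edge_eq_iff d (m.rev d)).2 (Or.inr rfl)).symm, h1,
        (m.rev_rev d).symm ▸ h2⟩
  choose c hc ht hh using h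
  exact ⟨⟨fun e => ⟨m.face (c e), Set.mem_univ _⟩, fun e => ⟨m.face (m.rev (c e)), Set.mem_univ _⟩,
    fun e => ⟨c e, hc e, rfl, rfl⟩⟩,
    fun e he => ⟨c ⟨e, he⟩, hc ⟨e, he⟩, ht ⟨e, he⟩, hh ⟨e, he⟩, rfl, rfl⟩⟩

end RotationSystem

end EGP

namespace EGP

universe u v w

/-! ### Permanents with repeated columns -/

/-! Let `A` and `H` be the reduced incidence matrices of the graph and its dual modulo `p`. Up to
the order of rows and columns, the two permanents belong to `A` and `H` with every row repeated `p -
1` times and every column repeated `b`, respectively `c`, times. Euler's formula gives `b + c = p -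
1`.

Expand a product of linear forms in variables attached to the columns: the coefficient of the
monomial with all exponents equal to `b` is a permanent with columns repeated `b` times, up to a
power of `b!`. Over `ZMod p` such a coefficient can be read off from a power sum
(`perm_comp_eq_power_sum`). Done with variables on the rows of `A`, this makes the first permanent
the sum of `∏ x_j ^ b` over the row space of `A` (`perm_eq_sum_vecMul`). The row space of `A` is the
kernel of `H`: potential differences sum to zero around a face, and the dimensions agree by Euler's
formula and connectedness of both graphs. The indicator function of the kernel is `∏ (1 - (Hx)_i ^
(p - 1))`, and for degree reasons only the full product of the powers `(Hx)_i ^ (p - 1)` survives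
summation (`sum_ker_eq`). What is left is the coefficient of `∏ x_j ^ c` in `∏ (Hx)_i ^ (p - 1)`,
that is, the dual permanent. The factorials combine by a form of Wilson's theorem
(`factorial_mul_factorial_of_add_eq`), and `perm_duality` collects all this. -/

theorem perm_eq_sum {R : Type*} [CommSemiring R] {m n : Type*} [Fintype m] [Fintype n]
    [DecidableEq m] [DecidableEq n] (A : Matrix m n R) :
    perm A = ∑ σ : m ≃ n, ∏ i, A i (σ i) := by
  unfold perm
  congr!

theorem map_perm {R S : Type*} [CommSemiring R] [CommSemiring S] (f : R →+* S) {m n : Type*}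
    [Fintype m] [Fintype n] (A : Matrix m n R) : f (perm A) = perm (A.map f) := by
  classical
  simp [perm_eq_sum, map_sum, map_prod]

theorem perm_transpose {R : Type*} [CommSemiring R] {m n : Type*} [Fintype m] [Fintype n]
    (A : Matrix m n R) : perm A.transpose = perm A := by
  classical
  simp only [perm_eq_sum]
  refine Fintype.sum_equiv (Equiv.mk Equiv.symm Equiv.symm (fun _ => rfl) fun _ => rfl) _ _
    fun σ => ?_
  refine Fintype.prod_equiv σ _ _ fun i => ?_
  simp

/-- If one lift of `φ` through `g` exists, composing with it identifies the lifts with the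
stabilizer of `φ` in the permutations of `R`, a product of symmetric groups on the fibres. A lift
exists exactly when corresponding fibres of `φ` and `g` have the same size. -/
theorem card_equiv_comp_eq {R C κ : Type*} [Fintype R] [Fintype C] [Fintype κ] [DecidableEq R]
    [DecidableEq C] [DecidableEq κ] {b : ℕ} (g : C → κ)
    (hg : ∀ j, Fintype.card {c // g c = j} = b) (φ : R → κ) :
    Fintype.card {σ : R ≃ C // g ∘ σ = φ} =
      if ∀ j, Fintype.card {i // φ i = j} = b then b.factorial ^ Fintype.card κ else 0 := by
  split_ifs with h
  · have e : ∀ j, {i // φ i = j} ≃ {c // g c = j} := fun j =>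
      Fintype.equivOfCardEq ((h j).trans (hg j).symm)
    obtain ⟨σ₀, h₀⟩ : ∃ σ₀ : R ≃ C, g ∘ σ₀ = φ :=
      ⟨Equiv.ofFiberEquiv e, funext fun i => Equiv.ofFiberEquiv_map e i⟩
    have h₁ : ∀ c, φ (σ₀.symm c) = g c := fun c => by simp [← h₀]
    have E : {σ : R ≃ C // g ∘ σ = φ} ≃ {τ : Equiv.Perm R // φ ∘ τ = φ} :=
      { toFun := fun σ => ⟨σ.1.trans σ₀.symm, by
          funext i
          exact (h₁ _).trans (congrFun σ.2 i)⟩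
        invFun := fun τ => ⟨τ.1.trans σ₀, by
          funext i
          exact (congrFun h₀ _).trans (congrFun τ.2 i)⟩
        left_inv := fun σ => by ext; simp
        right_inv := fun τ => by ext; simp }
    rw [Fintype.card_congr E, DomMulAct.stabilizer_card]
    simp [h]
  · rw [Fintype.card_eq_zero_iff]
    refine ⟨fun σ => h fun j => ?_⟩
    rw [← hg j]
    refine Fintype.card_congr (σ.1.subtypeEquiv fun i => ?_)
    rw [← congrFun σ.2 i]
    rfl

theorem perm_comp_eq_sum {F : Type*} [CommSemiring F] {R C κ : Type*} [Fintype R] [Fintype C]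
    [Fintype κ] [DecidableEq R] [DecidableEq κ] {b : ℕ} (g : C → κ)
    (hg : ∀ j, Fintype.card {c // g c = j} = b) (A : Matrix R κ F) :
    perm (Matrix.of fun i c => A i (g c)) =
      (b.factorial : F) ^ Fintype.card κ *
        ∑ φ : R → κ with ∀ j, Fintype.card {i // φ i = j} = b, ∏ i, A i (φ i) := by
  classical
  rw [perm_eq_sum, ← Finset.sum_fiberwise Finset.univ (fun σ : R ≃ C => g ∘ σ), Finset.mul_sum,
    Finset.sum_filter]
  refine Finset.sum_congr rfl fun φ _ => ?_
  rw [Finset.sum_congr rfl (g := fun _ => ∏ i, A i (φ i))]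
  · rw [Finset.sum_const, nsmul_eq_mul, ← Fintype.card_subtype, card_equiv_comp_eq g hg]
    split_ifs <;> simp
  · intro σ hσ
    rw [← (Finset.mem_filter.1 hσ).2]
    rfl

/-! ### Power sums over `ZMod p` and the duality of permanents -/

section PowerSums

variable {p : ℕ} [Fact p.Prime]

theorem sum_pow_sub_one : ∑ t : ZMod p, t ^ (p - 1) = -1 := by
  have h := (Fact.out : p.Prime).two_le
  rw [← Finset.sum_erase_add _ _ (Finset.mem_univ 0), zero_pow (by omega), add_zero,
    Finset.sum_congr rfl (g := fun _ => 1)]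
  · rw [Finset.sum_const, Finset.card_erase_of_mem (Finset.mem_univ _), Finset.card_univ,
      ZMod.card, nsmul_one, Nat.cast_sub (by omega)]
    simp
  · intro t ht
    exact ZMod.pow_card_sub_one_eq_one (Finset.ne_of_mem_erase ht)

/-- The sum factors over the variables. As the average exponent is `p - 1`, either all exponents
equal `p - 1` or one is smaller, and the power sum of that variable vanishes. -/
theorem sum_prod_pow {κ : Type*} [Fintype κ] [DecidableEq κ] (k : κ → ℕ)
    (hk : ∑ j, k j = (p - 1) * Fintype.card κ) :
    ∑ x : κ → ZMod p, ∏ j, x j ^ k j =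
      if ∀ j, k j = p - 1 then (-1) ^ Fintype.card κ else 0 := by
  rw [← Fintype.prod_sum (fun j (t : ZMod p) => t ^ k j)]
  split_ifs with h
  · simp [h, sum_pow_sub_one]
  · obtain ⟨j, hj⟩ : ∃ j, k j < p - 1 := by
      by_contra! hc
      refine h fun j => ?_
      have := (Finset.sum_eq_sum_iff_of_le (s := Finset.univ) fun j _ => hc j).1
        (by simp [hk, mul_comm])
      exact (this j (Finset.mem_univ j)).symm
    refine Finset.prod_eq_zero (Finset.mem_univ j) ?_
    exact FiniteField.sum_pow_lt_card_sub_one _ _ (by simpa [ZMod.card] using hj)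

/-- Multiplying by `∏ x_j ^ c` raises the exponents `b` to `p - 1`, so summing over all points
isolates exactly the monomial `∏ x_j ^ b` of the product of linear forms. The factor `(-1)` per
variable is the value of the sum of `t ^ (p - 1)`. -/
theorem perm_comp_eq_power_sum {R C κ : Type*} [Fintype R] [Fintype C] [Fintype κ]
    [DecidableEq κ] {b c : ℕ} (g : C → κ) (hg : ∀ j, Fintype.card {c // g c = j} = b)
    (hR : Fintype.card R = b * Fintype.card κ) (hbc : b + c = p - 1) (A : Matrix R κ (ZMod p)) :
    (-1) ^ Fintype.card κ * perm (Matrix.of fun i c => A i (g c)) =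
      (b.factorial : ZMod p) ^ Fintype.card κ *
        ∑ x : κ → ZMod p, (∏ i, A.mulVec x i) * ∏ j, x j ^ c := by
  classical
  rw [perm_comp_eq_sum g hg, mul_left_comm]
  congr 1
  have h : ∀ x : κ → ZMod p, (∏ i, A.mulVec x i) * ∏ j, x j ^ c =
      ∑ φ : R → κ, (∏ i, A i (φ i)) * ∏ j, x j ^ (Fintype.card {i // φ i = j} + c) := by
    intro x
    simp only [Matrix.mulVec, dotProduct]
    rw [Fintype.prod_sum, Finset.sum_mul]
    refine Finset.sum_congr rfl fun φ _ => ?_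
    rw [Finset.prod_mul_distrib, mul_assoc]
    congr 1
    rw [← Finset.prod_fiberwise Finset.univ φ, ← Finset.prod_mul_distrib]
    refine Finset.prod_congr rfl fun j _ => ?_
    rw [pow_add, Fintype.card_subtype, ← Finset.prod_const]
    congr 1
    refine Finset.prod_congr rfl fun i hi => ?_
    rw [(Finset.mem_filter.1 hi).2]
  rw [Finset.sum_congr rfl fun x _ => h x, Finset.sum_comm, Finset.mul_sum, Finset.sum_filter]
  refine Finset.sum_congr rfl fun φ _ => ?_
  rw [← Finset.mul_sum, sum_prod_pow]
  · have : (∀ j, Fintype.card {i // φ i = j} + c = p - 1) ↔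
        ∀ j, Fintype.card {i // φ i = j} = b := forall_congr' fun j => by omega
    simp only [this]
    split_ifs <;> ring
  · rw [Finset.sum_add_distrib, ← hbc, add_mul, ← hR]
    congr 1
    · rw [← Fintype.card_sigma]
      exact Fintype.card_congr (Equiv.sigmaFiberEquiv φ)
    · simp [mul_comm]

theorem prod_comp_fiber {F : Type*} [CommMonoid F] {C κ : Type*} [Fintype C] [Fintype κ]
    [DecidableEq κ] {b : ℕ} (g : C → κ) (hg : ∀ j, Fintype.card {c // g c = j} = b) (f : κ → F) :
    ∏ c, f (g c) = ∏ j, f j ^ b := by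
  rw [← Finset.prod_fiberwise Finset.univ g]
  refine Finset.prod_congr rfl fun j _ => ?_
  rw [← hg j, Fintype.card_subtype, ← Finset.prod_const]
  refine Finset.prod_congr rfl fun i hi => ?_
  rw [(Finset.mem_filter.1 hi).2]

theorem card_of_fiber {C κ : Type*} [Fintype C] [Fintype κ]
    [DecidableEq κ] {b : ℕ} (g : C → κ) (hg : ∀ j, Fintype.card {c // g c = j} = b) :
    Fintype.card C = b * Fintype.card κ := by
  rw [← Fintype.card_congr (Equiv.sigmaFiberEquiv g), Fintype.card_sigma]
  simp [hg, mul_comm]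

/-- The permanent of a matrix all of whose rows are repeated `p - 1` times, modulo `p`, as a sum
over the row space. -/
theorem perm_eq_sum_vecMul {R C ι κ : Type*} [Fintype R] [Fintype C] [Fintype ι] [Fintype κ]
    [DecidableEq ι] [DecidableEq κ] {b : ℕ} (f : R → ι) (g : C → κ)
    (hf : ∀ i, Fintype.card {r // f r = i} = p - 1) (hg : ∀ j, Fintype.card {c // g c = j} = b)
    (hRC : (p - 1) * Fintype.card ι = b * Fintype.card κ) (A : Matrix ι κ (ZMod p)) :
    perm (Matrix.of fun r c => A (f r) (g c)) =
      ∑ y : ι → ZMod p, ∏ j, A.vecMul y j ^ b := by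
  -- Applied to the transpose: the multiplicity is now `p - 1`, so no complementary monomial is
  -- needed.
  have h := perm_comp_eq_power_sum (p := p) (c := 0) f hf ((card_of_fiber g hg).trans hRC.symm)
    (add_zero _) (Matrix.of fun c i => A i (g c))
  rw [← perm_transpose]
  -- By Wilson's theorem the factorial factor equals the sign on the other side, and both cancel.
  have h1 : ((p - 1).factorial : ZMod p) = -1 := ZMod.wilsons_lemma p
  rw [h1] at h
  have h2 : ((-1 : ZMod p) ^ Fintype.card ι) ≠ 0 := pow_ne_zero _ (by simp)
  have h3 := mul_left_cancel₀ h2 h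
  refine Eq.trans ?_ (h3.trans ?_)
  · rfl
  · refine Finset.sum_congr rfl fun y _ => ?_
    simp only [pow_zero, Finset.prod_const_one, mul_one]
    rw [← prod_comp_fiber g hg]
    refine Finset.prod_congr rfl fun c _ => ?_
    simp [Matrix.mulVec, Matrix.vecMul, dotProduct, mul_comm]

/-- Starting from Wilson's theorem, moving one factor from `c!` to `b!` changes the sign, because `c
+ 1` and `b + 1` add up to `p`. -/
theorem factorial_mul_factorial_of_add_eq {b c : ℕ} (h : b + c = p - 1) :
    (b.factorial : ZMod p) * c.factorial = (-1) ^ (b + 1) := by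
  have hp := (Fact.out : p.Prime).two_le
  induction b generalizing c with
  | zero =>
    obtain rfl : c = p - 1 := by omega
    simp [ZMod.wilsons_lemma]
  | succ b ih =>
    have h1 := ih (c := c + 1) (by omega)
    have h2 : ((c + 1 : ℕ) : ZMod p) = -((b + 1 : ℕ) : ZMod p) := by
      rw [eq_neg_iff_add_eq_zero, ← Nat.cast_add, show c + 1 + (b + 1) = p by omega]
      simp
    rw [Nat.factorial_succ, Nat.cast_mul, h2] at h1
    rw [Nat.factorial_succ, Nat.cast_mul, pow_succ, ← h1]
    ring

open MvPolynomial in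
/-- The sum over the kernel of a matrix of a monomial whose degree is complementary to the number
of rows. -/
theorem sum_ker_eq {ι κ : Type*} [Fintype ι] [Fintype κ] [DecidableEq ι]
    [DecidableEq κ] {b : ℕ}
    (hb : b * Fintype.card κ + (p - 1) * Fintype.card ι = (p - 1) * Fintype.card κ)
    (H : Matrix ι κ (ZMod p)) :
    ∑ x : κ → ZMod p with H.mulVec x = 0, ∏ j, x j ^ b =
      (-1) ^ Fintype.card ι * ∑ x : κ → ZMod p, (∏ i, H.mulVec x i ^ (p - 1)) * ∏ j, x j ^ b := by
  classical
  have hp := (Fact.out : p.Prime).two_le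
  -- Fermat's little theorem gives the indicator of the kernel as `∏ (1 - (Hx)_i ^ (p - 1))`,
  -- expanded here over the subsets `S` of rows.
  have h1 : ∀ x : κ → ZMod p, (if H.mulVec x = 0 then ∏ j, x j ^ b else 0) =
      ∑ S : Finset ι, (∏ i ∈ S, -(H.mulVec x i ^ (p - 1))) * ∏ j, x j ^ b := by
    intro x
    rw [← Finset.sum_mul, ← Finset.powerset_univ, ← Finset.prod_one_add]
    split_ifs with h
    · simp [h, zero_pow (show p - 1 ≠ 0 by omega)]
    · obtain ⟨i, hi⟩ := Function.ne_iff.1 h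
      rw [Finset.prod_eq_zero (Finset.mem_univ i), zero_mul]
      rw [ZMod.pow_card_sub_one_eq_one hi]
      ring
  rw [Finset.sum_filter, Finset.sum_congr rfl fun x _ => h1 x, Finset.sum_comm,
    Finset.sum_eq_single Finset.univ]
  · rw [Finset.mul_sum]
    refine Finset.sum_congr rfl fun x _ => ?_
    rw [Finset.prod_neg, Finset.card_univ, mul_assoc]
  · intro S _ hS
    -- For a proper subset `S` the degree is below `(p - 1) * |κ|`, so the sum over all points
    -- vanishes, as in the Chevalley–Warning theorem.
    set P : MvPolynomial κ (ZMod p) :=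
      (∏ i ∈ S, -((∑ j, C (H i j) * X j) ^ (p - 1))) * ∏ j, X j ^ b with hP
    have h2 : ∀ x, (∏ i ∈ S, -(H.mulVec x i ^ (p - 1))) * ∏ j, x j ^ b = eval x P := by
      intro x
      simp [hP, Matrix.mulVec, dotProduct]
    rw [Finset.sum_congr rfl fun x _ => h2 x]
    apply MvPolynomial.sum_eval_eq_zero
    rw [ZMod.card, ← hb]
    have hlt : S.card < Fintype.card ι := by
      rw [← Finset.card_univ]
      exact Finset.card_lt_card (Finset.ssubset_univ_iff.2 hS)
    have hlin : ∀ i, (∑ j, C (H i j) * X j : MvPolynomial κ (ZMod p)).totalDegree ≤ 1 := fun i =>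
      totalDegree_finsetSum_le fun j _ => (totalDegree_mul _ _).trans (by simp)
    calc P.totalDegree
        ≤ (∏ i ∈ S, -((∑ j, C (H i j) * X j) ^ (p - 1)) : MvPolynomial κ (ZMod p)).totalDegree +
          (∏ j, X j ^ b : MvPolynomial κ (ZMod p)).totalDegree := totalDegree_mul _ _
      _ ≤ ∑ i ∈ S, (p - 1) + ∑ j : κ, b := by
        refine add_le_add ?_ ?_
        · refine (totalDegree_finsetProd _ _).trans (Finset.sum_le_sum fun i _ => ?_)
          rw [totalDegree_neg]
          refine (totalDegree_pow _ _).trans ?_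
          simpa using Nat.mul_le_mul_left (p - 1) (hlin i)
        · refine (totalDegree_finsetProd _ _).trans (Finset.sum_le_sum fun j _ => ?_)
          simp
      _ < b * Fintype.card κ + (p - 1) * Fintype.card ι := by
        simp only [Finset.sum_const, smul_eq_mul, Finset.card_univ]
        have := Nat.mul_lt_mul_of_pos_left hlt (show 0 < p - 1 by omega)
        linarith [mul_comm b (Fintype.card κ), mul_comm (p - 1) S.card]
  · simp

/-- Duality of permanents modulo `p` for a pair of matrices of full rank whose row spaces are
orthogonal complements of each other. -/
theorem perm_duality {R C R' C' ι ι' κ : Type*} [Fintype R] [Fintype C] [Fintype R'] [Fintype C']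
    [Fintype ι] [Fintype ι'] [Fintype κ] [DecidableEq ι] [DecidableEq ι'] [DecidableEq κ]
    {b c : ℕ} (f : R → ι) (g : C → κ) (f' : R' → ι') (g' : C' → κ)
    (hf : ∀ i, Fintype.card {r // f r = i} = p - 1) (hg : ∀ j, Fintype.card {c // g c = j} = b)
    (hf' : ∀ i, Fintype.card {r // f' r = i} = p - 1)
    (hg' : ∀ j, Fintype.card {c // g' c = j} = c)
    (hbc : b + c = p - 1) (hcard : Fintype.card ι + Fintype.card ι' = Fintype.card κ)
    (hRC : (p - 1) * Fintype.card ι = b * Fintype.card κ)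
    (A : Matrix ι κ (ZMod p)) (H : Matrix ι' κ (ZMod p))
    (hinj : Function.Injective A.vecMul) (hAH : ∀ x, H.mulVec x = 0 ↔ ∃ y, A.vecMul y = x) :
    perm (Matrix.of fun r c => A (f r) (g c)) =
      (-1) ^ Fintype.card ι' * (b.factorial : ZMod p) ^ Fintype.card κ *
        perm (Matrix.of fun r c => H (f' r) (g' c)) := by
  have hRC' : (p - 1) * Fintype.card ι' = c * Fintype.card κ := by
    have : (p - 1) * Fintype.card ι + (p - 1) * Fintype.card ι' =
        b * Fintype.card κ + c * Fintype.card κ := by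
      rw [← mul_add, ← add_mul, hcard, hbc]
    omega
  have h1 : ∑ y : ι → ZMod p, ∏ j, A.vecMul y j ^ b =
      ∑ x : κ → ZMod p with H.mulVec x = 0, ∏ j, x j ^ b := by
    refine Finset.sum_bij (fun y _ => A.vecMul y) (fun y _ => ?_) (fun y _ z _ h => hinj h)
      (fun x hx => ?_) fun y _ => rfl
    · simp [hAH]
    · obtain ⟨y, hy⟩ := (hAH x).1 (Finset.mem_filter.1 hx).2
      exact ⟨y, Finset.mem_univ _, hy⟩
  have h2 := perm_comp_eq_power_sum (p := p) (c := b) g' hg' (by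
    rw [card_of_fiber f' hf', hRC']) (by omega) (Matrix.of fun r j => H (f' r) j)
  have h3 : ∀ x : κ → ZMod p, ∏ r, (Matrix.of fun r j => H (f' r) j).mulVec x r =
      ∏ i, H.mulVec x i ^ (p - 1) := fun x =>
    prod_comp_fiber f' hf' fun i => H.mulVec x i
  simp only [h3] at h2
  -- The sign `(-1) ^ (b * |κ|)` is trivial because `b * |κ|` is a multiple of `p - 1`.
  have h4 : (-1 : ZMod p) ^ ((b + 1) * Fintype.card κ) = (-1) ^ Fintype.card κ := by
    rw [add_mul, pow_add, ← hRC, pow_mul, ZMod.pow_card_sub_one_eq_one (by simp)]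
    simp
  rw [perm_eq_sum_vecMul f g hf hg hRC, h1, sum_ker_eq (by rw [← hRC, ← mul_add, hcard]), mul_assoc]
  congr 1
  have h5 : ((-1 : ZMod p) ^ Fintype.card κ) ≠ 0 := pow_ne_zero _ (by simp)
  apply mul_left_cancel₀ h5
  rw [mul_left_comm]
  refine Eq.trans ?_ (congrArg _ h2.symm)
  rw [← mul_assoc, ← mul_pow, factorial_mul_factorial_of_add_eq hbc, ← pow_mul, h4]

end PowerSums

/-! ### Orthogonal complements -/

/-- The row space of `A` lies in the kernel of `H`, and full row rank makes both dimensions equal to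
`|ι|`. -/
theorem mulVec_eq_zero_iff_of_orthogonal {F ι ι' κ : Type*} [Field F] [Fintype ι] [Fintype ι']
    [Fintype κ] (A : Matrix ι κ F) (H : Matrix ι' κ F) (hA : Function.Injective A.vecMul)
    (hH : Function.Injective H.vecMul)
    (hcard : Fintype.card ι + Fintype.card ι' = Fintype.card κ)
    (hAH : ∀ y, H.mulVec (A.vecMul y) = 0) (x : κ → F) :
    H.mulVec x = 0 ↔ ∃ y, A.vecMul y = x := by
  classical
  have h : LinearMap.range A.vecMulLinear = LinearMap.ker H.mulVecLin := by
    refine Submodule.eq_of_le_of_finrank_eq ?_ ?_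
    · rintro _ ⟨y, rfl⟩
      exact hAH y
    · have h1 := LinearMap.finrank_range_of_inj (f := A.vecMulLinear) hA
      have h2 := H.mulVecLin.finrank_range_add_finrank_ker
      have h3 := LinearMap.finrank_range_of_inj (f := H.vecMulLinear) hH
      have h4 : H.rank = Module.finrank F (LinearMap.range H.vecMulLinear) := by
        rw [← Matrix.rank_transpose, Matrix.rank, Matrix.mulVecLin_transpose]
      rw [Matrix.rank] at h4
      simp only [Module.finrank_fintype_fun_eq_card] at h1 h2 h3
      omega
  constructor
  · intro hx
    have : x ∈ LinearMap.range A.vecMulLinear := h ▸ hx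
    exact this
  · rintro ⟨y, rfl⟩
    exact hAH y

/-! ### Incidence matrices -/

section Incidence

variable {α : Type u} {β : Type v} {G : Graph α β}

open Classical in
theorem incidenceMatrix_apply (o : Orientation G) (x : V(G)) (e : E(G)) :
    incidenceMatrix o x e = (if o.head e = x then 1 else 0) - (if o.tail e = x then 1 else 0) :=
  rfl

/-- Deleting the row of `s` amounts to normalizing potentials to vanish at `s`; the row space then
consists of their differences along edges. -/
theorem vecMul_reducedIncidenceMatrix {F : Type*} [CommRing F] (o : Orientation G) (s : V(G))
    [Fintype {x : V(G) // x ≠ s}] (Y : V(G) → F) (hY : Y s = 0) (e : E(G)) :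
    ((reducedIncidenceMatrix o s).map (Int.cast : ℤ → F)).vecMul (fun x => Y x.1) e =
      Y (o.head e) - Y (o.tail e) := by
  classical
  have h : ∀ z : V(G), ∑ x : {x : V(G) // x ≠ s}, (if z = x.1 then Y x.1 else 0) = Y z := by
    intro z
    by_cases hz : z = s
    · subst hz
      rw [hY]
      exact Finset.sum_eq_zero fun x _ => if_neg fun h => x.2 h.symm
    · rw [Finset.sum_eq_single ⟨z, hz⟩]
      · simp
      · intro x _ hx
        exact if_neg fun h => hx (Subtype.ext h.symm)
      · simp
  simp only [Matrix.vecMul, dotProduct, Matrix.map_apply, reducedIncidenceMatrix,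
    Matrix.submatrix_apply, incidenceMatrix, Matrix.of_apply, id]
  push_cast
  simp only [mul_sub, Finset.sum_sub_distrib, mul_ite, mul_one, mul_zero, h]

open Classical in
/-- The extension of a function by zero at the special vertex. -/
noncomputable def extendByZero {F : Type*} [Zero F] {s : V(G)} (y : {x : V(G) // x ≠ s} → F) :
    V(G) → F :=
  fun x => if h : x = s then 0 else y ⟨x, h⟩

theorem extendByZero_self {F : Type*} [Zero F] {s : V(G)} (y : {x : V(G) // x ≠ s} → F) :
    extendByZero y s = 0 :=
  dif_pos rfl

theorem extendByZero_coe {F : Type*} [Zero F] {s : V(G)} (y : {x : V(G) // x ≠ s} → F) :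
    (fun x : {x : V(G) // x ≠ s} => extendByZero y x.1) = y :=
  funext fun x => dif_neg x.2

/-- A potential whose differences all vanish is constant along walks, hence zero everywhere once it
is zero at `s`. This works in every characteristic. -/
theorem vecMul_reducedIncidenceMatrix_injective {F : Type*} [Field F] (hG : IsConnected G)
    (o : Orientation G) (s : V(G)) [Fintype {x : V(G) // x ≠ s}] :
    Function.Injective ((reducedIncidenceMatrix o s).map (Int.cast : ℤ → F)).vecMul := by
  intro y z hyz
  have h0 : ((reducedIncidenceMatrix o s).map (Int.cast : ℤ → F)).vecMul (y - z) = 0 := by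
    rw [Matrix.sub_vecMul]
    exact sub_eq_zero.2 hyz
  rw [← sub_eq_zero]
  set Y := extendByZero (y - z) with hYdef
  rw [← extendByZero_coe (y - z), ← hYdef] at h0 ⊢
  have hs : Y s = 0 := extendByZero_self _
  have hlink : ∀ (a b : V(G)), G.Adj a b → Y a = Y b := by
    rintro a b ⟨e, he⟩
    have h1 := congrFun h0 ⟨e, he.edge_mem⟩
    rw [vecMul_reducedIncidenceMatrix o s Y hs] at h1
    have h2 := sub_eq_zero.1 h1
    rcases (o.isLink ⟨e, he.edge_mem⟩).eq_and_eq_or_eq_and_eq he with ⟨ha, hb⟩ | ⟨ha, hb⟩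
    · rw [Subtype.ext ha, Subtype.ext hb] at h2
      exact h2.symm
    · rw [Subtype.ext ha, Subtype.ext hb] at h2
      exact h2
  have hreach : ∀ a, Relation.ReflTransGen G.Adj s a → ∀ ha : a ∈ V(G), Y ⟨a, ha⟩ = 0 := by
    intro a h
    induction h with
    | refl => exact fun _ => hs
    | tail _ hab ih =>
      intro hb
      rw [← hlink ⟨_, hab.choose_spec.left_mem⟩ ⟨_, hb⟩ hab]
      exact ih _
  funext x
  exact hreach _ (hG.2 _ s.2 _ x.1.2) x.1.2

theorem exists_incidenceMatrix_eq_mul (o₁ o₂ : Orientation G) : ∃ ε : E(G) → ℤˣ,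
    ∀ x e, incidenceMatrix o₁ x e = ε e * incidenceMatrix o₂ x e := by
  have h : ∀ e, ∃ δ : ℤˣ, ∀ x, incidenceMatrix o₁ x e = δ * incidenceMatrix o₂ x e := by
    intro e
    rcases (o₁.isLink e).eq_and_eq_or_eq_and_eq (o₂.isLink e) with ⟨h1, h2⟩ | ⟨h1, h2⟩
    · replace h1 := Subtype.ext h1
      replace h2 := Subtype.ext h2
      exact ⟨1, fun x => by rw [incidenceMatrix_apply, incidenceMatrix_apply, h1, h2]; simp⟩
    · replace h1 := Subtype.ext h1
      replace h2 := Subtype.ext h2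
      exact ⟨-1, fun x => by rw [incidenceMatrix_apply, incidenceMatrix_apply, h1, h2]; simp⟩
  choose ε hε using h
  exact ⟨ε, fun x e => hε e x⟩

open Classical in
theorem incidenceMatrix_reverse (o : Orientation G) (e : E(G)) (x : V(G)) (f : E(G)) :
    incidenceMatrix (o.reverse e) x f =
      ((if f = e then -1 else 1 : ℤˣ) : ℤ) * incidenceMatrix o x f := by
  by_cases h : f = e <;> simp [incidenceMatrix, Orientation.reverse, h]

end Incidence

/-! ### Rotation systems -/

namespace RotationSystem

variable {α : Type u} {β : Type v} {G : Graph α β} {D : Type w}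

theorem face_facePerm (m : RotationSystem G D) (d : D) : m.face (m.facePerm d) = m.face d :=
  Quotient.sound (Equiv.Perm.sameCycle_apply_left.2 (Equiv.Perm.SameCycle.refl _ _))

theorem vert_facePerm (m : RotationSystem G D) (d : D) :
    m.vert (m.facePerm d) = m.vert (m.rev d) :=
  (m.vert_eq_iff _ _).2 (Equiv.Perm.sameCycle_apply_left.2 (Equiv.Perm.SameCycle.refl _ _))

theorem edge_rev (m : RotationSystem G D) (d : D) : m.edge (m.rev d) = m.edge d :=
  ((m.edge_eq_iff d (m.rev d)).2 (Or.inr rfl)).symm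

theorem dual_adj_rev (m : RotationSystem G D) (d : D) :
    m.dual.Adj (m.face d) (m.face (m.rev d)) :=
  ⟨m.edge d, d, rfl, rfl, rfl⟩

/-- The face of `next d` is that of `rev d`, so turning around a vertex crosses one edge at a time.
-/
theorem dual_reachable_of_sameCycle_next [Finite D] (m : RotationSystem G D) {d d' : D}
    (h : m.next.SameCycle d d') :
    Relation.ReflTransGen m.dual.Adj (m.face d) (m.face d') := by
  obtain ⟨i, -, rfl⟩ := h.exists_pow_eq'
  induction i with
  | zero => exact Relation.ReflTransGen.refl
  | succ i ih =>
    refine (ih (Equiv.Perm.sameCycle_pow_right.2 (Equiv.Perm.SameCycle.refl _ _))).tail ?_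
    have h1 : m.face ((m.next ^ (i + 1)) d) = m.face (m.rev ((m.next ^ i) d)) := by
      rw [← m.face_facePerm (m.rev _), facePerm, Equiv.trans_apply, m.rev_rev, pow_succ']
      rfl
    rw [h1]
    exact m.dual_adj_rev _

theorem exists_dart_of_isLink (m : RotationSystem G D) {e : β} {x y : α} (h : G.IsLink e x y) :
    ∃ d, m.edge d = e ∧ m.vert d = x ∧ m.vert (m.rev d) = y := by
  obtain ⟨d, rfl⟩ := m.exists_dart e h.edge_mem
  rcases (m.isLink d).eq_and_eq_or_eq_and_eq h with ⟨h1, h2⟩ | ⟨h1, h2⟩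
  · exact ⟨d, rfl, h1, h2⟩
  · exact ⟨m.rev d, m.edge_rev d, h2, (m.rev_rev d).symm ▸ h1⟩

theorem dual_isConnected [Finite D] [Nonempty D] (m : RotationSystem G D) (hG : IsConnected G) :
    IsConnected m.dual := by
  have h : ∀ (d : D) (x : α), Relation.ReflTransGen G.Adj (m.vert d) x → ∀ d', m.vert d' = x →
      Relation.ReflTransGen m.dual.Adj (m.face d) (m.face d') := by
    intro d x hx
    induction hx with
    | refl =>
      exact fun d' h => m.dual_reachable_of_sameCycle_next ((m.vert_eq_iff _ _).1 h.symm)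
    | tail _ hxy ih =>
      intro d' hd'
      obtain ⟨e, he⟩ := hxy
      obtain ⟨c, -, hc, hc'⟩ := m.exists_dart_of_isLink he
      exact ((ih c hc).tail (m.dual_adj_rev c)).trans
        (m.dual_reachable_of_sameCycle_next ((m.vert_eq_iff _ _).1 (hc'.trans hd'.symm)))
  refine ⟨⟨m.face (Classical.arbitrary D), Set.mem_univ _⟩, fun f _ g _ => ?_⟩
  obtain ⟨d, rfl⟩ := Quotient.exists_rep f
  obtain ⟨d', rfl⟩ := Quotient.exists_rep g
  exact h d _ (hG.2 _ (m.isLink d).left_mem _ (m.isLink d').left_mem) d' rfl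

theorem exists_isDualOrientation' (m : RotationSystem G D) (o' : Orientation m.dual) :
    ∃ o : Orientation G, m.IsDualOrientation o o' := by
  have h : ∀ e : E(G), ∃ d, m.edge d = e ∧ (o'.tail e : m.Face) = m.face d ∧
      (o'.head e : m.Face) = m.face (m.rev d) := by
    intro e
    obtain ⟨d, hd, h1, h2⟩ := o'.isLink e
    exact ⟨d, hd, h1.symm, h2.symm⟩
  choose c hc ht hh using h
  refine ⟨⟨fun e => ⟨m.vert (c e), (m.isLink (c e)).left_mem⟩,
    fun e => ⟨m.vert (m.rev (c e)), (m.isLink (c e)).right_mem⟩, fun e => ?_⟩,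
    fun e he => ⟨c ⟨e, he⟩, hc ⟨e, he⟩, rfl, rfl, ht ⟨e, he⟩, hh ⟨e, he⟩⟩⟩
  have := m.isLink (c e)
  rwa [hc] at this

/-- A sum over all darts, as a sum over the edges, for any choice of a dart on each edge. -/
theorem sum_dart_eq {F : Type*} [AddCommMonoid F] [Fintype D] [Fintype E(G)]
    (m : RotationSystem G D) (c : E(G) → D) (hc : ∀ e, m.edge (c e) = e) (f : D → F) :
    ∑ d, f d = ∑ e, (f (c e) + f (m.rev (c e))) := by
  classical
  rw [← Finset.sum_fiberwise Finset.univ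
    (fun d => (⟨m.edge d, (m.isLink d).edge_mem⟩ : E(G)))]
  refine Finset.sum_congr rfl fun e _ => ?_
  rw [← Finset.sum_pair (m.rev_ne (c e)).symm]
  refine Finset.sum_congr ?_ fun _ _ => rfl
  ext d
  simp only [Finset.mem_filter, Finset.mem_univ, true_and, Finset.mem_insert,
    Finset.mem_singleton, ← m.edge_eq_iff (c e) d, hc, Subtype.ext_iff]
  exact eq_comm

/-- The boundary of a face is a closed walk, so potential differences along it telescope. Summing
over darts rather than edges also covers edges with the same face on both sides. -/
theorem sum_incidence_dual_mul_eq_zero {F : Type*} [CommRing F] [Finite D] [Fintype E(G)]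
    (m : RotationSystem G D) (o : Orientation G) (o' : Orientation m.dual)
    (h : m.IsDualOrientation o o') (f : V(m.dual)) (Y : V(G) → F) :
    ∑ e : E(G), (incidenceMatrix o' f e : F) * (Y (o.head e) - Y (o.tail e)) = 0 := by
  classical
  have := Fintype.ofFinite D
  choose c hc ht hh ht' hh' using fun e : E(G) => h e e.2
  let Z : D → F := fun d => Y ⟨m.vert d, (m.isLink d).left_mem⟩
  have hZt : ∀ e, Y (o.tail e) = Z (c e) := fun e => congrArg Y (Subtype.ext (ht e))
  have hZh : ∀ e, Y (o.head e) = Z (m.rev (c e)) := fun e => congrArg Y (Subtype.ext (hh e))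
  have hZf : ∀ d, Z (m.facePerm d) = Z (m.rev d) := fun d =>
    congrArg Y (Subtype.ext (m.vert_facePerm d))
  have hinc : ∀ e : E(G), (incidenceMatrix o' f e : F) =
      (if m.face (m.rev (c e)) = f then 1 else 0) - (if m.face (c e) = f then 1 else 0) := by
    intro e
    have h1 : o'.tail e = f ↔ m.face (c e) = f := by rw [Subtype.ext_iff]; exact ht' e ▸ Iff.rfl
    have h2 : o'.head e = f ↔ m.face (m.rev (c e)) = f := by
      rw [Subtype.ext_iff]; exact hh' e ▸ Iff.rfl
    have h3 : incidenceMatrix o' f e = (if m.face (m.rev (c e)) = f then 1 else 0) -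
        (if m.face (c e) = f then 1 else 0) :=
      (incidenceMatrix_apply o' f e).trans
        (congrArg₂ _ (if_congr h2 rfl rfl) (if_congr h1 rfl rfl))
    rw [h3]
    push_cast
    rfl
  -- The telescoping is the reindexing by `facePerm`, which preserves faces and moves each dart to
  -- one starting at its end.
  have key : ∑ d, (if m.face d = f then (Z d - Z (m.rev d)) else 0) = 0 := by
    have h1 : ∀ d, (if m.face d = f then (Z d - Z (m.rev d)) else 0) =
        (if m.face d = f then Z d else 0) -
          (if m.face (m.facePerm d) = f then Z (m.facePerm d) else 0) := by
      intro d
      rw [m.face_facePerm, hZf]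
      split_ifs <;> simp
    rw [Finset.sum_congr rfl fun d _ => h1 d, Finset.sum_sub_distrib, sub_eq_zero]
    exact (Equiv.sum_comp m.facePerm fun d => if m.face d = f then Z d else 0).symm
  rw [sum_dart_eq m c hc] at key
  rw [← key]
  refine Finset.sum_congr rfl fun e _ => ?_
  rw [hinc, hZt, hZh, m.rev_rev]
  split_ifs <;> ring

end RotationSystem

/-! ### The extended graph permanent -/

theorem card_snd_snd_fiber {ι : Type*} [Fintype ι] [DecidableEq ι] (n a : ℕ) (i : ι) :
    Fintype.card {r : Fin n × Fin a × ι // r.2.2 = i} = n * a := by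
  have e : {r : Fin n × Fin a × ι // r.2.2 = i} ≃ Fin n × Fin a :=
    { toFun := fun r => (r.1.1, r.1.2.1)
      invFun := fun q => ⟨(q.1, q.2, i), rfl⟩
      left_inv := by rintro ⟨⟨a, b, c⟩, rfl⟩; rfl
      right_inv := fun _ => rfl }
  rw [Fintype.card_congr e]
  simp

theorem perm_col_mul {R : Type*} [CommSemiring R] {m n : Type*} [Fintype m] [Fintype n]
    (c : n → R) (A : Matrix m n R) :
    perm (Matrix.of fun i j => c j * A i j) = (∏ j, c j) * perm A := by
  classical
  rw [perm_eq_sum, perm_eq_sum, Finset.mul_sum]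
  refine Finset.sum_congr rfl fun σ _ => ?_
  simp only [Matrix.of_apply]
  rw [Finset.prod_mul_distrib, Equiv.prod_comp σ c]

theorem card_subtype_ne {V : Type*} [Finite V] (s : V) [Fintype {x : V // x ≠ s}] :
    Fintype.card {x : V // x ≠ s} = Nat.card V - 1 := by
  classical
  have := Fintype.ofFinite V
  rw [Nat.card_eq_fintype_card, ← Set.card_ne_eq s]
  exact Fintype.card_congr (Equiv.refl _)

section GPerm

variable {α : Type u} {β : Type v} {G : Graph α β}

theorem rowCopies_mul : rowCopies G * (Nat.card V(G) - 1) =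
    Nat.lcm (Nat.card V(G) - 1) (Nat.card E(G)) :=
  Nat.div_mul_cancel (Nat.dvd_lcm_left _ _)

theorem colCopies_mul : colCopies G * Nat.card E(G) =
    Nat.lcm (Nat.card V(G) - 1) (Nat.card E(G)) :=
  Nat.div_mul_cancel (Nat.dvd_lcm_right _ _)

theorem rowCopies_eq_div_gcd (hV : 1 < Nat.card V(G)) :
    rowCopies G = Nat.card E(G) / Nat.gcd (Nat.card V(G) - 1) (Nat.card E(G)) := by
  rw [rowCopies, Nat.lcm, Nat.mul_div_assoc _ (Nat.gcd_dvd_right _ _),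
    Nat.mul_div_cancel_left _ (by omega)]

theorem rowCopies_pos (hV : 1 < Nat.card V(G)) (hE : 0 < Nat.card E(G)) : 0 < rowCopies G := by
  rw [rowCopies_eq_div_gcd hV]
  exact Nat.div_pos (Nat.gcd_le_right _ hE) (Nat.gcd_pos_of_pos_right _ hE)

theorem rowCopies_eq_two (hV : 1 < Nat.card V(G))
    (h : Nat.card E(G) = 2 * (Nat.card V(G) - 1)) : rowCopies G = 2 := by
  rw [rowCopies_eq_div_gcd hV, h, Nat.gcd_mul_left_right, Nat.mul_div_cancel _ (by omega)]

theorem colCopies_eq_one (hV : 1 < Nat.card V(G))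
    (h : Nat.card E(G) = 2 * (Nat.card V(G) - 1)) : colCopies G = 1 := by
  have h1 := colCopies_mul (G := G)
  rw [← rowCopies_mul, rowCopies_eq_two hV h, ← h] at h1
  exact Nat.eq_of_mul_eq_mul_right (show 0 < Nat.card E(G) by omega) (by rw [h1, one_mul])

theorem isGPermPrime_nth (hV : 1 < Nat.card V(G)) (hE : 0 < Nat.card E(G)) (i : ℕ) :
    IsGPermPrime G (Nat.nth (IsGPermPrime G) i) := by
  -- Infinitely many primes are congruent to `1` modulo `rowCopies G`, so `Nat.nth` never takes its
  -- default value `0`.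
  refine Nat.nth_mem_of_infinite ?_ i
  have hrow := rowCopies_pos hV hE
  refine (Nat.infinite_setOfPred_prime_modEq_one hrow.ne').mono ?_
  rintro p ⟨hp, hmod⟩
  obtain ⟨n, hn⟩ := (Nat.modEq_iff_dvd' hp.one_lt.le).1 hmod.symm
  have := hp.two_le
  refine ⟨hp, n, Nat.pos_of_ne_zero ?_, ?_⟩
  · rintro rfl
    omega
  · rw [mul_comm, ← hn]
    omega

variable [Finite V(G)] [Finite E(G)]

theorem gPerm_eq (o : Orientation G) (s : V(G)) {n p : ℕ} (h : (p - 1) / rowCopies G = n) :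
    gPerm o s p = perm (Matrix.of fun (r : Fin n × Fin (rowCopies G) × {x : V(G) // x ≠ s})
      (c : Fin n × Fin (colCopies G) × E(G)) =>
        (reducedIncidenceMatrix o s).map (Int.cast : ℤ → ZMod p) r.2.2 c.2.2) := by
  have := Fintype.ofFinite V(G)
  have := Fintype.ofFinite E(G)
  have := Fintype.ofFinite {x : V(G) // x ≠ s}
  subst h
  have h := map_perm (Int.castRingHom (ZMod p))
    (onesMatrix ((p - 1) / rowCopies G) ((p - 1) / rowCopies G) ⊗ₖ fundamentalMatrix o s)
  refine h.trans (congrArg perm ?_)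
  ext r c
  simp [onesMatrix, fundamentalMatrix]

theorem gPerm_of_incidenceMatrix_eq_mul (o₁ o₂ : Orientation G) (s : V(G)) {n p : ℕ}
    [Fintype E(G)] (ε : E(G) → ℤˣ)
    (hε : ∀ x e, incidenceMatrix o₁ x e = ε e * incidenceMatrix o₂ x e)
    (h : (p - 1) / rowCopies G = n) :
    gPerm o₁ s p = ((((∏ e, ε e : ℤˣ) : ℤ) : ZMod p)) ^ (n * colCopies G) * gPerm o₂ s p := by
  classical
  have := Fintype.ofFinite V(G)
  rw [gPerm_eq o₁ s h, gPerm_eq o₂ s h]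
  have h1 : ((((∏ e, ε e : ℤˣ) : ℤ) : ZMod p)) ^ (n * colCopies G) =
      ∏ c : Fin n × Fin (colCopies G) × E(G), ((ε c.2.2 : ℤ) : ZMod p) := by
    rw [prod_comp_fiber (fun c : Fin n × Fin (colCopies G) × E(G) => c.2.2)
      (card_snd_snd_fiber _ _) fun e => ((ε e : ℤ) : ZMod p)]
    push_cast
    rw [Finset.prod_pow]
  rw [h1, ← perm_col_mul]
  congr 1
  ext r c
  simp [reducedIncidenceMatrix, hε]

end GPerm

/-! ### Permanents of a plane graph and of its dual -/

section Duality

variable {α : Type u} {β : Type v} {G : Graph α β} {D : Type w}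

theorem RotationSystem.IsPlane.card_dual {m : RotationSystem G D} (hm : m.IsPlane) :
    Nat.card V(G) + Nat.card V(m.dual) = Nat.card E(G) + 2 := by
  have h1 : Nat.card V(m.dual) = Nat.card m.Face := Nat.card_congr (Equiv.Set.univ _)
  unfold RotationSystem.IsPlane at hm
  omega

/-- By Euler's formula, passing to the dual replaces `|V| - 1` by `|E| - (|V| - 1)`, which has the
same gcd with `|E|`. -/
theorem RotationSystem.IsPlane.rowCopies_dual {m : RotationSystem G D} (hm : m.IsPlane)
    (hV : 1 < Nat.card V(G)) (hE : Nat.card V(G) - 1 < Nat.card E(G)) :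
    rowCopies m.dual = rowCopies G := by
  have h := hm.card_dual
  have hE' : Nat.card E(m.dual) = Nat.card E(G) := rfl
  rw [rowCopies_eq_div_gcd hV, rowCopies_eq_div_gcd (by omega), hE']
  congr 1
  rw [show Nat.card V(m.dual) - 1 = Nat.card E(G) - (Nat.card V(G) - 1) by omega]
  exact Nat.gcd_self_sub_left hE.le

/-- This makes the column multiplicities at `p` add up to `p - 1`, as the duality of permanents
requires. -/
theorem RotationSystem.IsPlane.colCopies_add_colCopies_dual {m : RotationSystem G D}
    (hm : m.IsPlane) (hV : 1 < Nat.card V(G)) (hE : Nat.card V(G) - 1 < Nat.card E(G)) :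
    colCopies G + colCopies m.dual = rowCopies G := by
  have h := hm.card_dual
  have hE' : Nat.card E(m.dual) = Nat.card E(G) := rfl
  apply Nat.eq_of_mul_eq_mul_right (show 0 < Nat.card E(G) by omega)
  rw [add_mul, colCopies_mul, ← hE', colCopies_mul, hE', ← rowCopies_mul, ← hE', ← rowCopies_mul,
    hm.rowCopies_dual hV hE, ← mul_add, hE']
  congr 1
  omega

theorem isGPermPrime_iff {m : RotationSystem G D} (hm : m.IsPlane) (hV : 1 < Nat.card V(G))
    (hE : Nat.card V(G) - 1 < Nat.card E(G)) (p : ℕ) :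
    IsGPermPrime G p ↔ IsGPermPrime m.dual p := by
  rw [IsGPermPrime, IsGPermPrime, hm.rowCopies_dual hV hE]

variable [Finite V(G)] [Finite E(G)] [Finite D]

theorem gPerm_duality (hconn : IsConnected G) (hV : 1 < Nat.card V(G))
    (hE : Nat.card V(G) - 1 < Nat.card E(G)) (m : RotationSystem G D) (hm : m.IsPlane)
    (o : Orientation G) (o' : Orientation m.dual) (h : m.IsDualOrientation o o')
    (s : V(G)) (s' : V(m.dual)) (n p : ℕ) (hp : p.Prime)
    (hpn : p = n * rowCopies G + 1) :
    gPerm o s p = (-1) ^ (Nat.card E(G) + 1 - Nat.card V(G)) *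
      ((n * colCopies G).factorial : ZMod p) ^ Nat.card E(G) * gPerm o' s' p := by
  classical
  have := Fintype.ofFinite V(G)
  have := Fintype.ofFinite E(G)
  have := Fintype.ofFinite V(m.dual)
  have : Fact p.Prime := ⟨hp⟩
  have hrow := rowCopies_pos hV (by omega)
  have hrow' := hm.rowCopies_dual hV hE
  have hcard := hm.card_dual
  have hn : (p - 1) / rowCopies G = n := by
    rw [hpn, Nat.add_sub_cancel, Nat.mul_div_cancel _ hrow]
  have hn' : (p - 1) / rowCopies m.dual = n := by rw [hrow', hn]
  have hι : Fintype.card {x : V(G) // x ≠ s} = Nat.card V(G) - 1 := card_subtype_ne s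
  have hι' : Fintype.card {x : V(m.dual) // x ≠ s'} = Nat.card V(m.dual) - 1 := card_subtype_ne s'
  have hκ : Fintype.card E(G) = Nat.card E(G) := Nat.card_eq_fintype_card.symm
  have hsum : Fintype.card {x : V(G) // x ≠ s} + Fintype.card {x : V(m.dual) // x ≠ s'} =
      Fintype.card E(G) := by omega
  have : Nonempty D := by
    obtain ⟨e⟩ := (Finite.card_pos_iff (α := E(G))).1 (by omega)
    exact ⟨(m.exists_dart e e.2).choose⟩
  let A : Matrix {x : V(G) // x ≠ s} E(G) (ZMod p) := (reducedIncidenceMatrix o s).map Int.cast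
  let H : Matrix {x : V(m.dual) // x ≠ s'} E(G) (ZMod p) :=
    (reducedIncidenceMatrix o' s').map Int.cast
  have hA : Function.Injective A.vecMul := vecMul_reducedIncidenceMatrix_injective hconn o s
  have hH : Function.Injective H.vecMul :=
    vecMul_reducedIncidenceMatrix_injective (m.dual_isConnected hconn) o' s'
  have hAH : ∀ y, H.mulVec (A.vecMul y) = 0 := by
    intro y
    have h1 : A.vecMul y = fun e => extendByZero y (o.head e) - extendByZero y (o.tail e) := by
      funext e
      conv_lhs => rw [← extendByZero_coe y]
      exact vecMul_reducedIncidenceMatrix o s _ (extendByZero_self y) e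
    rw [h1]
    funext f
    exact m.sum_incidence_dual_mul_eq_zero o o' h f.1 (extendByZero y)
  rw [gPerm_eq o s hn, gPerm_eq o' s' hn']
  have key := perm_duality (p := p)
    (fun r : Fin n × Fin (rowCopies G) × {x : V(G) // x ≠ s} => r.2.2)
    (fun c : Fin n × Fin (colCopies G) × E(G) => c.2.2)
    (fun r : Fin n × Fin (rowCopies m.dual) × {x : V(m.dual) // x ≠ s'} => r.2.2)
    (fun c : Fin n × Fin (colCopies m.dual) × E(G) => c.2.2)
    (fun i => by rw [card_snd_snd_fiber]; omega) (card_snd_snd_fiber _ _)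
    (fun i => by rw [card_snd_snd_fiber, hrow']; omega) (card_snd_snd_fiber _ _)
    (by rw [← mul_add, hm.colCopies_add_colCopies_dual hV hE]; omega) hsum
    (by rw [hι, hκ, mul_assoc, colCopies_mul, ← rowCopies_mul, ← mul_assoc]; congr 1; omega)
    A H hA (mulVec_eq_zero_iff_of_orthogonal A H hA hH hsum hAH)
  rw [hι', hκ, show Nat.card V(m.dual) - 1 = Nat.card E(G) + 1 - Nat.card V(G) by omega] at key
  exact key

theorem gPerm_duality_of_orientations (hconn : IsConnected G) (hV : 1 < Nat.card V(G))
    (hE : Nat.card V(G) - 1 < Nat.card E(G)) (m : RotationSystem G D) (hm : m.IsPlane)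
    (o : Orientation G) (o' : Orientation m.dual) : ∃ ε : ℤˣ,
      ∀ (s : V(G)) (s' : V(m.dual)) (n p : ℕ), p.Prime → p = n * rowCopies G + 1 →
        gPerm o s p = (((ε : ℤ) : ZMod p)) ^ (n * colCopies G) *
          ((-1) ^ (Nat.card E(G) + 1 - Nat.card V(G)) *
            ((n * colCopies G).factorial : ZMod p) ^ Nat.card E(G) * gPerm o' s' p) := by
  have := Fintype.ofFinite E(G)
  -- Reorienting `G` rather than its dual yields the exponent `n * colCopies G` directly, since this
  -- is the number of copies of each edge column.
  obtain ⟨o₂, h₂⟩ := m.exists_isDualOrientation' o'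
  obtain ⟨ε, hε⟩ := exists_incidenceMatrix_eq_mul o o₂
  refine ⟨∏ e, ε e, fun s s' n p hp hpn => ?_⟩
  have hn : (p - 1) / rowCopies G = n := by
    rw [hpn, Nat.add_sub_cancel, Nat.mul_div_cancel _ (rowCopies_pos hV (by omega))]
  rw [gPerm_of_incidenceMatrix_eq_mul o o₂ s ε hε hn,
    gPerm_duality hconn hV hE m hm o₂ o' h₂ s s' n p hp hpn]

theorem gPerm_reverse (hV : 1 < Nat.card V(G)) (hE : 0 < Nat.card E(G)) (o : Orientation G)
    (e : E(G)) (s : V(G)) {n p : ℕ} (hpn : p = n * rowCopies G + 1) :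
    gPerm (o.reverse e) s p = (-1) ^ (n * colCopies G) * gPerm o s p := by
  classical
  have := Fintype.ofFinite E(G)
  have hn : (p - 1) / rowCopies G = n := by
    rw [hpn, Nat.add_sub_cancel, Nat.mul_div_cancel _ (rowCopies_pos hV hE)]
  rw [gPerm_of_incidenceMatrix_eq_mul (o.reverse e) o s (fun f => if f = e then -1 else 1)
    (fun x f => incidenceMatrix_reverse o e x f) hn]
  simp

theorem gPerm_eq_gPerm_dual (hconn : IsConnected G) (hV : 1 < Nat.card V(G))
    (hE : Nat.card E(G) = 2 * (Nat.card V(G) - 1)) (m : RotationSystem G D) (hm : m.IsPlane)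
    (o : Orientation G) (o' : Orientation m.dual) : ∃ ε : ℤˣ,
      ∀ (s : V(G)) (s' : V(m.dual)) (n p : ℕ), p.Prime → p = 2 * n + 1 →
        gPerm o s p = (((ε : ℤ) : ZMod p)) ^ n * gPerm o' s' p := by
  obtain ⟨ε, hε⟩ := gPerm_duality_of_orientations hconn hV (by omega) m hm o o'
  -- With `k = |V| - 1` and `(n!) ^ 2 = (-1) ^ (n + 1)`, the factor `(-1) ^ k * (n!) ^ (2 * k)`
  -- equals `(-1) ^ (k * (n + 2))`, the `n`-th power of `(-1) ^ k`.
  refine ⟨ε * (-1) ^ (Nat.card V(G) - 1), fun s s' n p hp hpn => ?_⟩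
  have : Fact p.Prime := ⟨hp⟩
  rw [hε s s' n p hp (by rw [rowCopies_eq_two hV hE, mul_comm]; exact hpn),
    colCopies_eq_one hV hE, mul_one, ← mul_assoc]
  congr 1
  have hfac : (n.factorial : ZMod p) ^ 2 = (-1) ^ (n + 1) := by
    rw [sq, factorial_mul_factorial_of_add_eq (by omega)]
  rw [hE, show 2 * (Nat.card V(G) - 1) + 1 - Nat.card V(G) = Nat.card V(G) - 1 by omega, pow_mul,
    hfac]
  push_cast
  rw [mul_pow, ← mul_pow, ← pow_succ', ← pow_mul, ← pow_mul]
  congr 1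
  rw [show (n + 1 + 1) * (Nat.card V(G) - 1) =
    (Nat.card V(G) - 1) * n + 2 * (Nat.card V(G) - 1) by ring, pow_add]
  simp

theorem extendedGraphPermanent_eq_dual {m : RotationSystem G D} (hm : m.IsPlane)
    (hV : 1 < Nat.card V(G)) (hE : Nat.card V(G) - 1 < Nat.card E(G)) (o : Orientation G)
    (o' : Orientation m.dual) (s : V(G)) (s' : V(m.dual))
    (h : ∀ n p : ℕ, p.Prime → p = n * rowCopies G + 1 → gPerm o s p = gPerm o' s' p) :
    extendedGraphPermanent o s = extendedGraphPermanent o' s' := by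
  funext i
  have h1 : IsGPermPrime m.dual = IsGPermPrime G :=
    funext fun p => propext (isGPermPrime_iff hm hV hE p).symm
  unfold extendedGraphPermanent
  rw [h1]
  obtain ⟨hp, n, -, hn⟩ := isGPermPrime_nth hV (by omega) i
  rw [h n _ hp hn]

end Duality

end EGP

theorem mainTheorem3 {α : Type*} {β : Type*} {D : Type*} (G : Graph α β)
    [Finite V(G)] [Finite E(G)] [Finite D]
    (hconn : EGP.IsConnected G) (hV : 1 < Nat.card V(G))
    (hE : Nat.card V(G) - 1 < Nat.card E(G))
    (m : EGP.RotationSystem G D) (hm : m.IsPlane) :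
    -- the two extended graph permanents are defined at the same primes
    (∀ p : ℕ, EGP.IsGPermPrime G p ↔ EGP.IsGPermPrime m.dual p) ∧
    -- the duality formula, for dual orientations
    (∀ (o : EGP.Orientation G) (o' : EGP.Orientation m.dual), m.IsDualOrientation o o' →
      ∀ (s : V(G)) (s' : V(m.dual)) (n p : ℕ), 0 < n → p.Prime →
        p = n * EGP.rowCopies G + 1 →
        EGP.gPerm o s p =
          (-1) ^ (Nat.card E(G) + 1 - Nat.card V(G)) *
            ((n * EGP.colCopies G).factorial : ZMod p) ^ Nat.card E(G) *
            EGP.gPerm o' s' p) ∧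
    -- for arbitrary orientations it holds up to one sign, which appears at all primes
    -- that use an odd number of copies of each column
    (∀ (o : EGP.Orientation G) (o' : EGP.Orientation m.dual), ∃ ε : ℤˣ,
      ∀ (s : V(G)) (s' : V(m.dual)) (n p : ℕ), 0 < n → p.Prime →
        p = n * EGP.rowCopies G + 1 →
        EGP.gPerm o s p =
          (((ε : ℤ) : ZMod p)) ^ (n * EGP.colCopies G) *
            ((-1) ^ (Nat.card E(G) + 1 - Nat.card V(G)) *
              ((n * EGP.colCopies G).factorial : ZMod p) ^ Nat.card E(G) *
              EGP.gPerm o' s' p)) ∧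
    -- equality of the extended graph permanents, up to the sign convention
    (Nat.card E(G) = 2 * (Nat.card V(G) - 1) →
      ∀ (o : EGP.Orientation G) (o' : EGP.Orientation m.dual),
        (∃ ε : ℤˣ, ∀ (s : V(G)) (s' : V(m.dual)) (n p : ℕ), 0 < n → p.Prime → p = 2 * n + 1 →
          EGP.gPerm o s p = (((ε : ℤ) : ZMod p)) ^ n * EGP.gPerm o' s' p) ∧
        ((∀ (s : V(G)) (s' : V(m.dual)),
            EGP.extendedGraphPermanent o s = EGP.extendedGraphPermanent o' s') ∨
          (∀ (s : V(G)) (s' : V(m.dual)) (e : E(G)),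
            EGP.extendedGraphPermanent (o.reverse e) s =
              EGP.extendedGraphPermanent o' s'))) := by
  refine ⟨EGP.isGPermPrime_iff hm hV hE, ?_, ?_, ?_⟩
  · intro o o' h s s' n p _ hp hpn
    exact EGP.gPerm_duality hconn hV hE m hm o o' h s s' n p hp hpn
  · intro o o'
    obtain ⟨ε, hε⟩ := EGP.gPerm_duality_of_orientations hconn hV hE m hm o o'
    exact ⟨ε, fun s s' n p _ => hε s s' n p⟩
  · intro h2 o o'
    obtain ⟨ε, hε⟩ := EGP.gPerm_eq_gPerm_dual hconn hV h2 m hm o o'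
    refine ⟨⟨ε, fun s s' n p _ => hε s s' n p⟩, ?_⟩
    have hrow := EGP.rowCopies_eq_two hV h2
    rcases Int.units_eq_one_or ε with rfl | rfl
    · refine Or.inl fun s s' =>
        EGP.extendedGraphPermanent_eq_dual hm hV hE o o' s s' fun n p hp hpn => ?_
      rw [hε s s' n p hp (by rw [hpn, hrow, mul_comm])]
      simp
    -- Each column has `n` copies here, so reversing one edge contributes `(-1) ^ n`, cancelling the
    -- sign at every prime simultaneously.
    · refine Or.inr fun s s' e =>
        EGP.extendedGraphPermanent_eq_dual hm hV hE _ o' s s' fun n p hp hpn => ?_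
      rw [EGP.gPerm_reverse hV (by omega) o e s hpn, EGP.colCopies_eq_one hV h2, mul_one,
        hε s s' n p hp (by rw [hpn, hrow, mul_comm]), ← mul_assoc, ← mul_pow]
      simp
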